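/- Let $(\mathbb I,d)$ be a separable metric space with its Borel $\sigma$-algebra (for example an interval of $\mathbb R$ with $d(x,y)=|x-y|$), let $n\in\mathbb N$ and $\kappa>0$. A matrix-valued measure on a measurable space is a countably additive set function on it with values in $\mathbb C^{n\times n}$. Write $\|A\|$ for the operator norm and $\|A\|_*$ for the nuclear norm (the sum of the singular values) of $A\in\mathbb C^{n\times n}$. For a matrix-valued measure $m$ let $\|dm\|_*$ be its variation with respect to the nuclear norm, i.e. the nonnegative measure $E\mapsto\sup\sum_i\|m(E_i)\|_*$, the supremum being over finite measurable partitions $(E_i)$ of $E$, and let $\|\mu\|_{\rm TV}=\int_{\mathbb I}\|d\mu\|_*$. For Hermitian-valued measures $\mu_1,\mu_2$ on $\mathbb I$ define $$d_{W_1,\kappa}(\mu_1,\mu_2)=\sup_f\Big\{\int_{\mathbb I}\operatorname{tr}\big(f\,(d\mu_1-d\mu_2)\big)\Big\},$$ where $f$ ranges over the functions from $\mathbb I$ to the Hermitian $n\times n$ matrices with $\|f(x)-f(y)\|\le d(x,y)$ and $\|f(x)\|\le\kappa$ for all $x,y\in\mathbb I$. For matrix-valued measures $\hat\mu_1,\hat\mu_2$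 on $\mathbb I$ define $$d_{W_1}(\hat\mu_1,\hat\mu_2)=\inf_m\int_{\mathbb I\times\mathbb I}d(x,y)\,\|dm(x,y)\|_*\in[0,\infty],$$ where $m$ ranges over all matrix-valued measures on $\mathbb I\times\mathbb I$ (not necessarily positive semidefinite) with marginals $\hat\mu_1$ and $\hat\mu_2$ (the infimum is $\infty$ if there are none, i.e. if $\hat\mu_1(\mathbb I)\ne\hat\mu_2(\mathbb I)$). If the values of $\mu_1$ and $\mu_2$ are positive semidefinite, then $$d_{W_1,\kappa}(\mu_1,\mu_2)=\inf_{\hat\mu_1,\hat\mu_2}\Big\{d_{W_1}(\hat\mu_1,\hat\mu_2)+\kappa\sum_{k=1}^2\|\mu_k-\hat\mu_k\|_{\rm TV}\Big\},$$ where $\hat\mu_1,\hat\mu_2$ range over the positive-semidefinite-valued measures on $\mathbb I$. If the values of $\mu_1$ and $\mu_2$ are merely Hermitian, the same identity holds with $\hat\mu_1,\hat\mu_2$ ranging over all Hermitian-valued measures on $\mathbb I$. -/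

import Mathlib

noncomputable section

namespace MatricialTransport

open MeasureTheory
open scoped ENNReal ComplexOrder Matrix.Norms.L2Operator

/-- Complex `n × n` matrices. In this namespace `‖A‖` is the operator norm (largest singular value)
of such a matrix. -/
abbrev CMat (n : ℕ) : Type := Matrix (Fin n) (Fin n) ℂ

section NuclearNorm

variable {n : ℕ}

/-- The nuclear norm `‖A‖_*`: the sum of the singular values of `A`. -/
def nuclearNorm (A : CMat n) : ℝ :=
  ∑ i : Fin n, (Matrix.toEuclideanLin A).singularValues i

theorem nuclearNorm_nonneg (A : CMat n) : 0 ≤ nuclearNorm A :=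
  Finset.sum_nonneg fun _ _ => LinearMap.singularValues_nonneg _ _

/-- An orthonormal basis of right singular vectors. -/
theorem exists_singular_basis (T : EuclideanSpace ℂ (Fin n) →ₗ[ℂ] EuclideanSpace ℂ (Fin n)) :
    ∃ b : OrthonormalBasis (Fin n) ℂ (EuclideanSpace ℂ (Fin n)),
      ∀ i j, inner ℂ (T (b i)) (T (b j)) =
        if i = j then (((T.singularValues i) ^ 2 : ℝ) : ℂ) else 0 := by
  have hn : Module.finrank ℂ (EuclideanSpace ℂ (Fin n)) = n := by simp
  have hT := T.isSymmetric_adjoint_comp_self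
  refine ⟨hT.eigenvectorBasis hn, fun i j => ?_⟩
  have h1 : (LinearMap.adjoint T) (T (hT.eigenvectorBasis hn j)) =
      ((hT.eigenvalues hn j : ℝ) : ℂ) • hT.eigenvectorBasis hn j :=
    hT.apply_eigenvectorBasis hn j
  rw [← LinearMap.adjoint_inner_right, h1, inner_smul_right,
    orthonormal_iff_ite.mp (hT.eigenvectorBasis hn).orthonormal i j,
    T.sq_singularValues_fin hn]
  split_ifs with h
  · subst h; simp
  · simp

/-- The trace of a product in an orthonormal basis. -/
theorem trace_mul_eq_sum_inner (W A : CMat n)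
    (b : OrthonormalBasis (Fin n) ℂ (EuclideanSpace ℂ (Fin n))) :
    (W * A).trace = ∑ i, inner ℂ (b i) (Matrix.toEuclideanCLM (n := Fin n) (𝕜 := ℂ) W
        (Matrix.toEuclideanLin A (b i))) := by
  have h := LinearMap.trace_eq_sum_inner (Matrix.toEuclideanLin (W * A)) b
  have h' : LinearMap.trace ℂ _ (Matrix.toEuclideanLin (W * A)) = (W * A).trace := by
    rw [Matrix.toEuclideanLin_eq_toLin_orthonormal, Matrix.trace_toLin_eq]
  rw [← h', h]
  refine Finset.sum_congr rfl fun i _ => ?_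
  congr 1
  ext j
  simp [Matrix.mulVec_mulVec]

/-- Upper half of the duality between the nuclear and the operator norm. -/
theorem re_trace_mul_le_nuclearNorm (W A : CMat n) (hW : ‖W‖ ≤ 1) :
    (W * A).trace.re ≤ nuclearNorm A := by
  obtain ⟨b, hb⟩ := exists_singular_basis (Matrix.toEuclideanLin A)
  rw [trace_mul_eq_sum_inner W A b, Complex.re_sum, nuclearNorm]
  refine Finset.sum_le_sum fun i _ => ?_
  have h2 : ‖Matrix.toEuclideanLin A (b i)‖ = (Matrix.toEuclideanLin A).singularValues i := by
    have h4 := hb i i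
    have h3 : ‖Matrix.toEuclideanLin A (b i)‖ ^ 2
        = (Matrix.toEuclideanLin A).singularValues i ^ 2 := by
      rw [if_pos rfl] at h4
      rw [@norm_sq_eq_re_inner ℂ, h4]
      exact Complex.ofReal_re _
    exact (sq_eq_sq₀ (norm_nonneg _) (LinearMap.singularValues_nonneg _ _)).mp h3
  refine (Complex.re_le_norm _).trans ((norm_inner_le_norm _ _).trans ?_)
  rw [b.norm_eq_one, one_mul, ← h2]
  refine (ContinuousLinearMap.le_opNorm _ _).trans ?_
  rw [Matrix.l2_opNorm_toEuclideanCLM]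
  exact mul_le_of_le_one_left (norm_nonneg _) hW

/-- Lower half of the duality between the nuclear and the operator norm. -/
theorem exists_re_trace_mul_eq_nuclearNorm (A : CMat n) :
    ∃ W : CMat n, ‖W‖ ≤ 1 ∧ (W * A).trace.re = nuclearNorm A := by
  obtain ⟨b, hb⟩ := exists_singular_basis (Matrix.toEuclideanLin A)
  set T := Matrix.toEuclideanLin A with hT
  set σ : Fin n → ℝ := fun i => T.singularValues i with hσ
  let u : Fin n → EuclideanSpace ℂ (Fin n) := fun i => ((σ i)⁻¹ : ℂ) • T (b i)
  have hu : Orthonormal ℂ (fun i : {i // σ i ≠ 0} => u i) := by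
    rw [orthonormal_iff_ite]
    rintro ⟨i, hi⟩ ⟨j, hj⟩
    simp only [u, inner_smul_left, inner_smul_right, hb i j, Subtype.mk.injEq]
    split_ifs with h
    · subst h
      have hi' : (σ i : ℂ) ≠ 0 := by exact_mod_cast hi
      simp only [map_inv₀, Complex.conj_ofReal]
      change (σ i : ℂ)⁻¹ * ((σ i : ℂ)⁻¹ * ((σ i ^ 2 : ℝ) : ℂ)) = 1
      push_cast
      field_simp
    · simp
  have hbessel : ∀ x, ∑ i, ‖inner ℂ (u i) x‖ ^ 2 ≤ ‖x‖ ^ 2 := by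
    intro x
    have h1 := hu.sum_inner_products_le (x := x) (s := Finset.univ)
    refine le_trans (le_of_eq ?_) h1
    rw [← Finset.sum_subtype (Finset.univ.filter fun i => σ i ≠ 0) (by simp)
      (fun i => ‖inner ℂ (u i) x‖ ^ 2), Finset.sum_filter]
    refine Finset.sum_congr rfl fun i _ => ?_
    split_ifs with h
    · rfl
    · have h0 : σ i = 0 := not_not.mp h
      simp [u, h0]
  let L : EuclideanSpace ℂ (Fin n) →ₗ[ℂ] EuclideanSpace ℂ (Fin n) :=
    ∑ i, (innerₛₗ ℂ (u i)).smulRight (b i)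
  have hL : ∀ x, L x = ∑ i, inner ℂ (u i) x • b i := fun x => by simp [L]
  obtain ⟨W, hW⟩ := (Matrix.toEuclideanCLM (n := Fin n) (𝕜 := ℂ)).surjective
    (LinearMap.toContinuousLinearMap L)
  have hWx : ∀ x, Matrix.toEuclideanCLM (n := Fin n) (𝕜 := ℂ) W x = L x := fun x => by
    exact congrArg (fun S => S x) hW
  refine ⟨W, ?_, ?_⟩
  · rw [← Matrix.l2_opNorm_toEuclideanCLM]
    refine ContinuousLinearMap.opNorm_le_bound _ zero_le_one fun x => ?_
    rw [one_mul, hWx, ← sq_le_sq₀ (norm_nonneg _) (norm_nonneg _)]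
    refine le_trans (le_of_eq ?_) (hbessel x)
    rw [← b.sum_sq_norm_inner_right]
    refine Finset.sum_congr rfl fun i _ => ?_
    rw [hL, b.orthonormal.inner_right_fintype]
  · rw [trace_mul_eq_sum_inner W A b, Complex.re_sum, nuclearNorm]
    refine Finset.sum_congr rfl fun i _ => ?_
    rw [hWx, hL, b.orthonormal.inner_right_fintype]
    simp only [u, inner_smul_left]
    rw [hb i i, if_pos rfl, map_inv₀, Complex.conj_ofReal]
    change ((σ i : ℂ)⁻¹ * ((σ i ^ 2 : ℝ) : ℂ)).re = σ i
    rw [← Complex.ofReal_inv, ← Complex.ofReal_mul, Complex.ofReal_re]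
    by_cases h : σ i = 0
    · simp [h]
    · field_simp

theorem nuclearNorm_add_le (A B : CMat n) :
    nuclearNorm (A + B) ≤ nuclearNorm A + nuclearNorm B := by
  obtain ⟨W, hW, h⟩ := exists_re_trace_mul_eq_nuclearNorm (A + B)
  rw [← h, mul_add, Matrix.trace_add, Complex.add_re]
  exact add_le_add (re_trace_mul_le_nuclearNorm W A hW) (re_trace_mul_le_nuclearNorm W B hW)

theorem nuclearNorm_eq_zero_iff (A : CMat n) : nuclearNorm A = 0 ↔ A = 0 := by
  constructor
  · intro h
    rw [nuclearNorm, Finset.sum_eq_zero_iff_of_nonneg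
      fun _ _ => LinearMap.singularValues_nonneg _ _] at h
    rw [← LinearEquiv.map_eq_zero_iff (Matrix.toEuclideanLin (𝕜 := ℂ) (m := Fin n) (n := Fin n)),
      ← LinearMap.singularValues_eq_zero_iff]
    ext i
    by_cases hi : i < n
    · exact h ⟨i, hi⟩ (Finset.mem_univ _)
    · exact LinearMap.singularValues_of_finrank_le _ (by simpa using hi)
  · rintro rfl
    simp [nuclearNorm]

theorem nuclearNorm_le (A : CMat n) : nuclearNorm A ≤ n * ‖A‖ := by
  obtain ⟨b, hb⟩ := exists_singular_basis (Matrix.toEuclideanLin A)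
  obtain ⟨W, hW, h⟩ := exists_re_trace_mul_eq_nuclearNorm A
  rw [← h, trace_mul_eq_sum_inner W A b, Complex.re_sum]
  refine (Finset.sum_le_card_nsmul _ _ ‖A‖ fun i _ => ?_).trans (by simp)
  refine (Complex.re_le_norm _).trans ((norm_inner_le_norm _ _).trans ?_)
  rw [b.norm_eq_one, one_mul]
  have h1 := ContinuousLinearMap.le_opNorm (Matrix.toEuclideanCLM (n := Fin n) (𝕜 := ℂ) W)
    (Matrix.toEuclideanLin A (b i))
  have h2 := ContinuousLinearMap.le_opNorm (Matrix.toEuclideanCLM (n := Fin n) (𝕜 := ℂ) A) (b i)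
  rw [Matrix.l2_opNorm_toEuclideanCLM] at h1 h2
  rw [b.norm_eq_one, mul_one] at h2
  exact h1.trans ((mul_le_of_le_one_left (norm_nonneg _) hW).trans h2)

theorem continuous_nuclearNorm : Continuous (nuclearNorm : CMat n → ℝ) := by
  have key : ∀ A B : CMat n, nuclearNorm A ≤ nuclearNorm B + n * dist A B := fun A B => by
    have h1 := nuclearNorm_add_le B (A - B)
    rw [add_sub_cancel] at h1
    rw [dist_eq_norm]
    exact h1.trans (add_le_add le_rfl (nuclearNorm_le _))
  exact (LipschitzWith.of_le_add_mul (n : NNReal) (by simpa using key)).continuous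

/-- Matrices, with their usual topology, normed by the nuclear norm. -/
abbrev nuclearENormedAddCommMonoid (n : ℕ) : ENormedAddCommMonoid (CMat n) :=
  { (inferInstance : AddCommMonoid (CMat n)) with
    enorm := fun A => ENNReal.ofReal (nuclearNorm A)
    continuous_enorm := ENNReal.continuous_ofReal.comp continuous_nuclearNorm
    enorm_zero := by simp [(nuclearNorm_eq_zero_iff (0 : CMat n)).2 rfl]
    enorm_add_le := fun A B => by
      rw [← ENNReal.ofReal_add (nuclearNorm_nonneg A) (nuclearNorm_nonneg B)]
      exact ENNReal.ofReal_le_ofReal (nuclearNorm_add_le A B)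
    enorm_eq_zero := fun A => by
      rw [ENNReal.ofReal_eq_zero, ← nuclearNorm_eq_zero_iff]
      exact ⟨fun h => le_antisymm h (nuclearNorm_nonneg A), fun h => h.le⟩ }

end NuclearNorm

/-- A matrix-valued measure on `X`: a countably additive set function on the measurable sets with
values in the complex `n × n` matrices. -/
abbrev MatMeasure (X : Type*) [MeasurableSpace X] (n : ℕ) := VectorMeasure X (CMat n)

section Measures

variable {X : Type*} [MeasurableSpace X] {n : ℕ}

/-- The values of `μ` are Hermitian matrices. -/
def IsHermitianMeasure (μ : MatMeasure X n) : Prop :=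
  ∀ s, MeasurableSet s → (μ s).IsHermitian

/-- The values of `μ` are positive semidefinite Hermitian matrices. -/
def IsPosSemidefMeasure (μ : MatMeasure X n) : Prop :=
  ∀ s, MeasurableSet s → (μ s).PosSemidef

/-- The nonnegative measure `‖dm‖_*`: its value on a measurable set `E` is the supremum of
`∑ i, ‖m (E i)‖_*` over the finite measurable partitions `E i` of `E`. -/
def nuclearVariation (m : MatMeasure X n) : Measure X :=
  @VectorMeasure.variation X _ (CMat n) _ (nuclearENormedAddCommMonoid n) _ m

/-- The total variation `‖μ‖_TV = ∫ ‖dμ‖_*`. -/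
def tvNorm (μ : MatMeasure X n) : ℝ≥0∞ := nuclearVariation μ Set.univ

/-- The real bilinear pairing `(A, M) ↦ Re tr (A M)`, which is `tr (A M)` when `A` and `M` are
Hermitian. -/
def tracePairing (n : ℕ) : CMat n →L[ℝ] CMat n →L[ℝ] ℝ :=
  LinearMap.toContinuousLinearMap
    ((LinearMap.toContinuousLinearMap : (CMat n →ₗ[ℝ] ℝ) ≃ₗ[ℝ] (CMat n →L[ℝ] ℝ)).toLinearMap ∘ₗ
      LinearMap.mk₂ ℝ (fun A M : CMat n => (A * M).trace.re)
        (fun A B M => by simp [add_mul]) (fun c A M => by simp)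
        (fun A M N => by simp [mul_add]) (fun c A M => by simp))

theorem tracePairing_apply (A M : CMat n) : tracePairing n A M = (A * M).trace.re := rfl

/-- The integral `∫ tr (f dμ)`. -/
def traceIntegral (f : X → CMat n) (μ : MatMeasure X n) : ℝ :=
  μ.integral f (tracePairing n)

end Measures

section Distances

variable {X : Type*} [MetricSpace X] [MeasurableSpace X] {n : ℕ}

/-- The test functions: Hermitian-valued, `1`-Lipschitz from the metric of `X` to the operator norm,
and bounded by `κ` in operator norm. -/
def testFunctions (X : Type*) [MetricSpace X] (n : ℕ) (κ : ℝ) : Set (X → CMat n) :=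
  {f | (∀ x, (f x).IsHermitian) ∧ (∀ x y, ‖f x - f y‖ ≤ dist x y) ∧ ∀ x, ‖f x‖ ≤ κ}

/-- The dual-defined distance
`sup {∫ tr (f (dμ₁ - dμ₂)) | ‖f‖_Lip ≤ 1, ‖f‖ ≤ κ}`, in the extended reals. -/
def dualDist (κ : ℝ) (μ₁ μ₂ : MatMeasure X n) : EReal :=
  ⨆ f ∈ testFunctions X n κ, ((traceIntegral f (μ₁ - μ₂) : ℝ) : EReal)

/-- The couplings of `μ₁` and `μ₂`: all matrix-valued measures on `X × X`, with no positivity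
requirement, whose marginals are `μ₁` and `μ₂`. -/
def couplings (μ₁ μ₂ : MatMeasure X n) : Set (MatMeasure (X × X) n) :=
  {m | m.map Prod.fst = μ₁ ∧ m.map Prod.snd = μ₂}

/-- The matricial `1`-Wasserstein distance, the infimum of `∫ d(x, y) ‖dm(x, y)‖_*` over the
couplings `m`. It is `∞` if the total masses of `μ₁` and `μ₂` differ, as there is no coupling. -/
def matricialW1 (μ₁ μ₂ : MatMeasure X n) : ℝ≥0∞ :=
  ⨅ m ∈ couplings μ₁ μ₂, ∫⁻ p, edist p.1 p.2 ∂(nuclearVariation m)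

/-- The value of the unbalanced transport problem, where the auxiliary measures range over `𝒜`. -/
def unbalancedValue (𝒜 : Set (MatMeasure X n)) (κ : ℝ) (μ₁ μ₂ : MatMeasure X n) : ℝ≥0∞ :=
  ⨅ ν₁ ∈ 𝒜, ⨅ ν₂ ∈ 𝒜,
    matricialW1 ν₁ ν₂ + ENNReal.ofReal κ * (tvNorm (μ₁ - ν₁) + tvNorm (μ₂ - ν₂))

end Distances

end MatricialTransport

end

/-! The inequality `≤` is weak duality. For an admissible `f` and a plan `m` between `ν₁` and `ν₂`,
write `μ₁ - μ₂ = (ν₁ - ν₂) + (μ₁ - ν₁) - (μ₂ - ν₂)`. The Lipschitz bound controls the first term by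
the transport cost of `m`, and the bound `κ` controls the other two by total variation. The
constants are sharp because the nuclear norm is dual to the operator norm
(`enorm_traceIntegral_le`).

The inequality `≥` comes from Hahn-Banach on the finitely supported Hermitian measures. There every
linear functional is integration against a Hermitian-valued function, which need not hold on the
space of all measures. The least cost `minCost` of writing such a measure as a transported part plus
`P - Q`, with `P` and `Q` positive, is sublinear. A linear functional below it that attains it at a
given `s` yields `f`: comparison with the cost of dipoles makes `f` 1-Lipschitz, and comparison with
the cost of single atoms bounds it by `κ` (`exists_mem_testFunctions_feasible`). Rank-one positive
matrices suffice for both comparisons.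

A general difference `μ₁ - μ₂` is, outside a set of small mass, transported at small cost to a
finitely supported measure (`exists_discretization`). Both primal problems then follow at once. On
the large set `K` take `ν₁ = μ₁|K + Q` and `ν₂ = μ₂|K + P`: moving `Q` and `P` across the equation
means that only positive measures are added, so positivity is kept. Since plans may be signed, any
plan with the right difference of marginals becomes a coupling after adding a plan on the diagonal,
where the cost vanishes (`matricialW1_le_of_sub_eq`). -/

noncomputable section

namespace MatricialTransport

open MeasureTheory Filter Topology
open scoped ENNReal ComplexOrder Matrix Matrix.Norms.L2Operator

/-! ### Duality between the nuclear and the operator norm -/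

section NuclearNormMore

variable {n : ℕ}

theorem nuclearNorm_le_of_forall {A : CMat n} {c : ℝ}
    (h : ∀ W : CMat n, ‖W‖ ≤ 1 → (W * A).trace.re ≤ c) : nuclearNorm A ≤ c := by
  obtain ⟨W, hW, hA⟩ := exists_re_trace_mul_eq_nuclearNorm A
  exact hA ▸ h W hW

theorem nuclearNorm_neg (A : CMat n) : nuclearNorm (-A) = nuclearNorm A := by
  have key : ∀ B : CMat n, nuclearNorm (-B) ≤ nuclearNorm B := fun B =>
    nuclearNorm_le_of_forall fun W hW => by
      simpa using re_trace_mul_le_nuclearNorm (-W) B (by simpa using hW)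
  exact le_antisymm (key A) (by simpa using key (-A))

theorem nuclearNorm_smul_le {c : ℝ} (hc : 0 ≤ c) (A : CMat n) :
    nuclearNorm (c • A) ≤ c * nuclearNorm A :=
  nuclearNorm_le_of_forall fun W hW => by
    simpa using mul_le_mul_of_nonneg_left (re_trace_mul_le_nuclearNorm W A hW) hc

theorem nuclearNorm_smul_le_abs (c : ℝ) (A : CMat n) :
    nuclearNorm (c • A) ≤ |c| * nuclearNorm A := by
  rcases abs_cases c with ⟨h, hc⟩ | ⟨h, hc⟩
  · rw [h]
    exact nuclearNorm_smul_le hc A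
  · rw [h, ← nuclearNorm_neg, ← neg_smul]
    exact nuclearNorm_smul_le (by linarith) A

theorem nuclearNorm_sum_le {ι : Type*} (s : Finset ι) (A : ι → CMat n) :
    nuclearNorm (∑ i ∈ s, A i) ≤ ∑ i ∈ s, nuclearNorm (A i) := by
  classical
  induction s using Finset.induction_on with
  | empty => simp [(nuclearNorm_eq_zero_iff (0 : CMat n)).2 rfl]
  | insert i s his ih =>
    rw [Finset.sum_insert his, Finset.sum_insert his]
    exact (nuclearNorm_add_le _ _).trans (add_le_add le_rfl ih)

theorem re_trace_mul_le_norm_mul (W A : CMat n) :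
    (W * A).trace.re ≤ ‖W‖ * nuclearNorm A := by
  rcases eq_or_ne W 0 with rfl | hW
  · simp
  have hW' : 0 < ‖W‖ := norm_pos_iff.2 hW
  have h := re_trace_mul_le_nuclearNorm ((‖W‖⁻¹ : ℝ) • W) A
    (by rw [norm_smul]; simp [hW'.ne'])
  rw [Matrix.smul_mul, Matrix.trace_smul, Complex.smul_re, smul_eq_mul,
    inv_mul_le_iff₀ hW'] at h
  exact h

theorem abs_re_trace_mul_le (W A : CMat n) :
    |(W * A).trace.re| ≤ ‖W‖ * nuclearNorm A := by
  refine abs_le'.2 ⟨re_trace_mul_le_norm_mul W A, ?_⟩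
  simpa using re_trace_mul_le_norm_mul (-W) A

theorem trace_mul_vecMulVec_star (W : CMat n) (v : Fin n → ℂ) :
    (W * Matrix.vecMulVec v (star v)).trace =
      inner ℂ (WithLp.toLp 2 v)
        (Matrix.toEuclideanCLM (n := Fin n) (𝕜 := ℂ) W (WithLp.toLp 2 v)) := by
  rw [Matrix.mul_vecMulVec, Matrix.trace_vecMulVec, EuclideanSpace.inner_eq_star_dotProduct]
  simp

theorem nuclearNorm_vecMulVec_le (v : Fin n → ℂ) :
    nuclearNorm (Matrix.vecMulVec v (star v)) ≤ ‖WithLp.toLp 2 v‖ ^ 2 := by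
  refine nuclearNorm_le_of_forall fun W hW => ?_
  rw [trace_mul_vecMulVec_star]
  refine (Complex.re_le_norm _).trans ((norm_inner_le_norm _ _).trans ?_)
  have := (Matrix.toEuclideanCLM (n := Fin n) (𝕜 := ℂ) W).le_opNorm (WithLp.toLp 2 v)
  rw [Matrix.l2_opNorm_toEuclideanCLM] at this
  rw [sq]
  gcongr
  exact this.trans (mul_le_of_le_one_left (norm_nonneg _) hW)

/-- The operator norm of a Hermitian matrix is the supremum of its absolute Rayleigh quotients, and
`v* F v = tr (F v v*)`. Testing on rank-one positive matrices is convenient later, because for them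
the splitting `P - Q` is optimal with one part zero. -/
theorem norm_le_of_forall_abs_re_trace {F : CMat n} (hF : F.IsHermitian) {c : ℝ} (hc : 0 ≤ c)
    (h : ∀ v : Fin n → ℂ, |(F * Matrix.vecMulVec v (star v)).trace.re| ≤
      c * nuclearNorm (Matrix.vecMulVec v (star v))) : ‖F‖ ≤ c := by
  set T := Matrix.toEuclideanCLM (n := Fin n) (𝕜 := ℂ) F with hT
  have hsym : (T : EuclideanSpace ℂ (Fin n) →ₗ[ℂ] EuclideanSpace ℂ (Fin n)).IsSymmetric :=
    Matrix.isSymmetric_toEuclideanLin_iff.2 hF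
  rw [← Matrix.l2_opNorm_toEuclideanCLM, ← hT,
    ContinuousLinearMap.norm_eq_iSup_rayleighQuotient _ hsym]
  refine Real.iSup_le (fun x => ?_) hc
  rw [ContinuousLinearMap.rayleighQuotient, ContinuousLinearMap.reApplyInnerSelf_apply,
    abs_div, abs_sq]
  refine div_le_of_le_mul₀ (sq_nonneg _) hc ?_
  have h1 := (h x.ofLp).trans (mul_le_mul_of_nonneg_left (nuclearNorm_vecMulVec_le _) hc)
  rw [trace_mul_vecMulVec_star, ← Complex.conj_re, inner_conj_symm] at h1
  exact h1

end NuclearNormMore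

/-! ### Functionals on Hermitian matrices -/

section Riesz

variable {n : ℕ}

/-- The real vector space of Hermitian matrices. -/
abbrev HermMat (n : ℕ) : Submodule ℝ (CMat n) := selfAdjoint.submodule ℝ (CMat n)

theorem mem_hermMat {A : CMat n} : A ∈ HermMat n ↔ A.IsHermitian := Iff.rfl

/-- The trace pairing is nondegenerate on Hermitian matrices, as `tr (A A) = tr (Aᴴ A)` vanishes
only for `A = 0`. Equality of dimensions turns injectivity into surjectivity. -/
theorem exists_hermitian_repr (L : HermMat n →ₗ[ℝ] ℝ) :
    ∃ F : CMat n, F.IsHermitian ∧ ∀ A : HermMat n, L A = (F * A).trace.re := by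
  let Φ : HermMat n →ₗ[ℝ] Module.Dual ℝ (HermMat n) :=
    LinearMap.mk₂ ℝ (fun A M : HermMat n => ((A : CMat n) * M).trace.re)
        (fun A B M => by simp [add_mul]) (fun c A M => by simp)
        (fun A M N => by simp [mul_add]) (fun c A M => by simp)
  have hΦ : Function.Injective Φ := by
    rw [injective_iff_map_eq_zero]
    intro A hA
    have h0 : ((A : CMat n) * A).trace.re = 0 := congrArg (fun l => l A) hA
    have hH : (A : CMat n)ᴴ = A := A.2
    have h1 : ((A : CMat n)ᴴ * A).trace = 0 := by
      have hps := (Matrix.posSemidef_conjTranspose_mul_self (A : CMat n)).trace_nonneg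
      rw [hH] at hps ⊢
      exact Complex.ext h0 (Complex.nonneg_iff.1 hps).2.symm
    exact Subtype.ext (Matrix.trace_conjTranspose_mul_self_eq_zero_iff.1 h1)
  obtain ⟨F, hF⟩ := (LinearMap.injective_iff_surjective_of_finrank_eq_finrank
    (Subspace.dual_finrank_eq (K := ℝ) (V := HermMat n)).symm).1 hΦ L
  exact ⟨F, F.2, fun A => by rw [← hF]; rfl⟩

end Riesz

/-! ### A sharp bound for integrals against vector measures -/

section IntegralBound

variable {X E F G : Type*} [MeasurableSpace X] [NormedAddCommGroup E] [NormedSpace ℝ E]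
  [NormedAddCommGroup F] [NormedSpace ℝ F] [NormedAddCommGroup G] [NormedSpace ℝ G]

/-- The measure is regarded as taking values in the operators `a ↦ B a (μ s)`, so its size is
measured by the norm dual to that of `f`. Bounding by the norm of `B` and the variation of `μ` in
`F` would lose the sharp constant. -/
theorem enorm_integral_le_lintegral_of_forall (μ : VectorMeasure X F) (B : E →L[ℝ] F →L[ℝ] G)
    {l : Measure X} (f : X → E)
    (h : ∀ s, MeasurableSet s → ∀ a, ‖B a (μ s)‖ₑ ≤ l s * ‖a‖ₑ) :
    ‖μ.integral f B‖ₑ ≤ ∫⁻ x, ‖f x‖ₑ ∂l := by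
  refine VectorMeasure.enorm_integral_le_lintegral_enorm_transpose.trans ?_
  refine lintegral_mono' (VectorMeasure.variation_le_of_forall_enorm_le fun s hs => ?_) le_rfl
  exact ContinuousLinearMap.opENorm_le_bound _ fun a => h s hs a

end IntegralBound

/-! ### The nuclear variation of a matrix-valued measure -/

section NuclearVariation

variable {X : Type*} [MeasurableSpace X] {n : ℕ}

theorem nuclearNorm_le_nuclearVariation (m : MatMeasure X n) (E : Set X) :
    ENNReal.ofReal (nuclearNorm (m E)) ≤ nuclearVariation m E :=
  @VectorMeasure.enorm_measure_le_variation X (CMat n) _ _ (nuclearENormedAddCommMonoid n) _ m E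

theorem nuclearVariation_le_of_forall {m : MatMeasure X n} {l : Measure X}
    (h : ∀ E, MeasurableSet E → ENNReal.ofReal (nuclearNorm (m E)) ≤ l E) :
    nuclearVariation m ≤ l :=
  @VectorMeasure.variation_le_of_forall_enorm_le X (CMat n) _ _ (nuclearENormedAddCommMonoid n) _
    m l h

theorem nuclearVariation_add_le (m m' : MatMeasure X n) :
    nuclearVariation (m + m') ≤ nuclearVariation m + nuclearVariation m' := by
  refine nuclearVariation_le_of_forall fun E _ => ?_
  refine (ENNReal.ofReal_le_ofReal (nuclearNorm_add_le (m E) (m' E))).trans ?_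
  rw [ENNReal.ofReal_add (nuclearNorm_nonneg _) (nuclearNorm_nonneg _)]
  exact add_le_add (nuclearNorm_le_nuclearVariation m E) (nuclearNorm_le_nuclearVariation m' E)

theorem nuclearVariation_neg_le (m : MatMeasure X n) :
    nuclearVariation (-m) ≤ nuclearVariation m := by
  refine nuclearVariation_le_of_forall fun E _ => ?_
  change ENNReal.ofReal (nuclearNorm (-(m E))) ≤ _
  rw [nuclearNorm_neg]
  exact nuclearNorm_le_nuclearVariation m E

theorem nuclearVariation_sub_le (m m' : MatMeasure X n) :
    nuclearVariation (m - m') ≤ nuclearVariation m + nuclearVariation m' := by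
  rw [sub_eq_add_neg]
  exact (nuclearVariation_add_le _ _).trans (add_le_add le_rfl (nuclearVariation_neg_le _))

theorem nuclearVariation_zero : nuclearVariation (0 : MatMeasure X n) = 0 := by
  refine le_antisymm (nuclearVariation_le_of_forall fun E _ => ?_) (Measure.zero_le _)
  simp [(nuclearNorm_eq_zero_iff (0 : CMat n)).2 rfl]

theorem nuclearVariation_smul_le {c : ℝ} (hc : 0 ≤ c) (m : MatMeasure X n) :
    nuclearVariation (c • m) ≤ ENNReal.ofReal c • nuclearVariation m := by
  refine nuclearVariation_le_of_forall fun E _ => ?_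
  change ENNReal.ofReal (nuclearNorm (c • (m E))) ≤ _
  refine (ENNReal.ofReal_le_ofReal (nuclearNorm_smul_le hc (m E))).trans ?_
  rw [ENNReal.ofReal_mul hc, Measure.smul_apply, smul_eq_mul]
  gcongr
  exact nuclearNorm_le_nuclearVariation m E

theorem nuclearVariation_sum_le {ι : Type*} (s : Finset ι) (m : ι → MatMeasure X n) :
    nuclearVariation (∑ i ∈ s, m i) ≤ ∑ i ∈ s, nuclearVariation (m i) := by
  classical
  induction s using Finset.induction_on with
  | empty => simp [nuclearVariation_zero]
  | insert i s his ih =>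
    rw [Finset.sum_insert his, Finset.sum_insert his]
    exact (nuclearVariation_add_le _ _).trans (add_le_add le_rfl ih)

theorem nuclearVariation_restrict_le (m : MatMeasure X n) {s : Set X} (hs : MeasurableSet s) :
    nuclearVariation (m.restrict s) ≤ (nuclearVariation m).restrict s := by
  refine nuclearVariation_le_of_forall fun E hE => ?_
  rw [VectorMeasure.restrict_apply _ hs hE, Measure.restrict_apply hE]
  exact nuclearNorm_le_nuclearVariation m _

theorem nuclearVariation_map_le {Y : Type*} [MeasurableSpace Y] (m : MatMeasure X n) {φ : X → Y}
    (hφ : Measurable φ) : nuclearVariation (m.map φ) ≤ (nuclearVariation m).map φ := by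
  refine nuclearVariation_le_of_forall fun E hE => ?_
  rw [VectorMeasure.map_apply _ hφ hE, Measure.map_apply hφ hE]
  exact nuclearNorm_le_nuclearVariation m _

theorem nuclearVariation_dirac_le (x : X) (A : CMat n) :
    nuclearVariation (VectorMeasure.dirac x A : MatMeasure X n) ≤
      ENNReal.ofReal (nuclearNorm A) • Measure.dirac x := by
  refine nuclearVariation_le_of_forall fun E hE => ?_
  by_cases hx : x ∈ E
  · simp [hx, hE]
  · simp [hx, hE, (nuclearNorm_eq_zero_iff (0 : CMat n)).2 rfl]

/-- Expand `x` in a basis of right singular vectors: each term of `A x` has norm at most `σᵢ ‖x‖`.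
This lets finiteness pass from the nuclear variation to the operator-norm variation, with respect to
which integrability is defined. -/
theorem norm_le_nuclearNorm (A : CMat n) : ‖A‖ ≤ nuclearNorm A := by
  obtain ⟨b, hb⟩ := exists_singular_basis (Matrix.toEuclideanLin A)
  have hσ : ∀ i, ‖Matrix.toEuclideanLin A (b i)‖ = (Matrix.toEuclideanLin A).singularValues i := by
    intro i
    refine (sq_eq_sq₀ (norm_nonneg _) (LinearMap.singularValues_nonneg _ _)).mp ?_
    rw [@norm_sq_eq_re_inner ℂ, hb i i, if_pos rfl]
    exact Complex.ofReal_re _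
  rw [← Matrix.l2_opNorm_toEuclideanCLM]
  refine ContinuousLinearMap.opNorm_le_bound _ (nuclearNorm_nonneg _) fun x => ?_
  change ‖Matrix.toEuclideanLin A x‖ ≤ _
  conv_lhs => rw [← b.sum_repr' x, map_sum]
  rw [nuclearNorm, Finset.sum_mul]
  refine norm_sum_le_of_le _ fun i _ => ?_
  rw [map_smul, norm_smul, hσ, mul_comm]
  gcongr
  · exact LinearMap.singularValues_nonneg _ _
  · simpa [b.norm_eq_one] using norm_inner_le_norm (𝕜 := ℂ) (b i) x

theorem variation_le_nuclearVariation (m : MatMeasure X n) :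
    m.variation ≤ nuclearVariation m := by
  refine VectorMeasure.variation_le_of_forall_enorm_le fun E _ => ?_
  rw [← ofReal_norm]
  exact (ENNReal.ofReal_le_ofReal (norm_le_nuclearNorm _)).trans
    (nuclearNorm_le_nuclearVariation m E)

/-- In a real basis of the matrices the coordinates of `m` are signed measures, which have finite
total variation. A weighted sum of these dominates the nuclear variation. -/
instance isFiniteMeasure_nuclearVariation (m : MatMeasure X n) :
    IsFiniteMeasure (nuclearVariation m) := by
  let b := Module.finBasis ℝ (CMat n)
  let r : Fin (Module.finrank ℝ (CMat n)) → SignedMeasure X := fun i =>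
    m.mapRange (b.coord i).toAddMonoidHom (LinearMap.continuous_of_finiteDimensional (b.coord i))
  let l : Measure X := ∑ i, ENNReal.ofReal (nuclearNorm (b i)) • (r i).totalVariation
  have hl : nuclearVariation m ≤ l := by
    refine nuclearVariation_le_of_forall fun E _ => ?_
    have h1 : nuclearNorm (m E) ≤ ∑ i, |r i E| * nuclearNorm (b i) := by
      conv_lhs => rw [← b.sum_repr (m E)]
      exact (nuclearNorm_sum_le _ _).trans
        (Finset.sum_le_sum fun i _ => nuclearNorm_smul_le_abs _ _)
    refine (ENNReal.ofReal_le_ofReal h1).trans ?_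
    rw [ENNReal.ofReal_sum_of_nonneg fun i _ => mul_nonneg (abs_nonneg _) (nuclearNorm_nonneg _)]
    simp only [l, Measure.coe_finsetSum, Finset.sum_apply, Measure.smul_apply, smul_eq_mul]
    refine Finset.sum_le_sum fun i _ => ?_
    rw [ENNReal.ofReal_mul (abs_nonneg _), mul_comm]
    gcongr
    rw [← Real.enorm_eq_ofReal_abs]
    exact SignedMeasure.enorm_le_totalVariation _ _
  have : IsFiniteMeasure l := by
    refine ⟨?_⟩
    simp only [l, Measure.coe_finsetSum, Finset.sum_apply, Measure.smul_apply, smul_eq_mul]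
    exact ENNReal.sum_lt_top.2 fun i _ =>
      ENNReal.mul_lt_top ENNReal.ofReal_lt_top (measure_lt_top _ _)
  exact isFiniteMeasure_of_le l hl

instance isFiniteMeasure_variation (m : MatMeasure X n) :
    IsFiniteMeasure m.variation :=
  isFiniteMeasure_of_le _ (variation_le_nuclearVariation m)

theorem enorm_traceIntegral_le (f : X → CMat n) (m : MatMeasure X n) :
    ‖traceIntegral f m‖ₑ ≤ ∫⁻ x, ‖f x‖ₑ ∂(nuclearVariation m) := by
  refine enorm_integral_le_lintegral_of_forall m (tracePairing n) f fun s _ A => ?_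
  refine le_trans ?_ (mul_le_mul_left (nuclearNorm_le_nuclearVariation m s) _)
  rw [tracePairing_apply, Real.enorm_eq_ofReal_abs, ← ofReal_norm,
    ← ENNReal.ofReal_mul (nuclearNorm_nonneg _), mul_comm]
  exact ENNReal.ofReal_le_ofReal (abs_re_trace_mul_le A (m s))

theorem tvNorm_sub_le (m m' : MatMeasure X n) : tvNorm (m - m') ≤ tvNorm m + tvNorm m' :=
  nuclearVariation_sub_le m m' Set.univ

theorem tvNorm_add_le (m m' : MatMeasure X n) : tvNorm (m + m') ≤ tvNorm m + tvNorm m' :=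
  nuclearVariation_add_le m m' Set.univ

end NuclearVariation

/-! ### Test functions and weak duality -/

section TestFunctions

variable {X : Type*} [MetricSpace X] {n : ℕ} {κ : ℝ} {f : X → CMat n}

theorem zero_mem_testFunctions (hκ : 0 ≤ κ) : (0 : X → CMat n) ∈ testFunctions X n κ :=
  ⟨fun _ => Matrix.isHermitian_zero, fun x y => by simp, fun x => by simpa using hκ⟩

theorem continuous_of_mem_testFunctions (hf : f ∈ testFunctions X n κ) : Continuous f :=
  (LipschitzWith.of_dist_le_mul (K := 1) fun x y => by
    simpa [dist_eq_norm] using hf.2.1 x y).continuous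

variable [MeasurableSpace X]

theorem enorm_traceIntegral_le_mul_tvNorm (hf : f ∈ testFunctions X n κ) (m : MatMeasure X n) :
    ‖traceIntegral f m‖ₑ ≤ ENNReal.ofReal κ * tvNorm m := by
  refine (enorm_traceIntegral_le f m).trans ?_
  rw [tvNorm, ← lintegral_const]
  refine lintegral_mono fun x => ?_
  rw [← ofReal_norm]
  exact ENNReal.ofReal_le_ofReal (hf.2.2 x)

variable [BorelSpace X]

theorem integrable_of_mem_testFunctions (hf : f ∈ testFunctions X n κ) (m : MatMeasure X n) :
    m.Integrable f :=
  Integrable.of_bound (continuous_of_mem_testFunctions hf).aestronglyMeasurable κ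
    (Eventually.of_forall hf.2.2)


theorem traceIntegral_sub (hf : f ∈ testFunctions X n κ) (m m' : MatMeasure X n) :
    traceIntegral f (m - m') = traceIntegral f m - traceIntegral f m' :=
  VectorMeasure.integral_sub_vectorMeasure (integrable_of_mem_testFunctions hf m)
    (integrable_of_mem_testFunctions hf m')

theorem traceIntegral_add (hf : f ∈ testFunctions X n κ) (m m' : MatMeasure X n) :
    traceIntegral f (m + m') = traceIntegral f m + traceIntegral f m' :=
  VectorMeasure.integral_add_vectorMeasure (integrable_of_mem_testFunctions hf m)
    (integrable_of_mem_testFunctions hf m')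

variable [SecondCountableTopology X]

theorem enorm_traceIntegral_map_sub_map_le (hf : f ∈ testFunctions X n κ)
    (M : MatMeasure (X × X) n) :
    ‖traceIntegral f (M.map Prod.fst - M.map Prod.snd)‖ₑ ≤
      ∫⁻ p, edist p.1 p.2 ∂(nuclearVariation M) := by
  have hc := continuous_of_mem_testFunctions hf
  have hi : ∀ φ : X × X → X, Continuous φ → M.Integrable (f ∘ φ) := fun φ hφ =>
    Integrable.of_bound (hc.comp hφ).aestronglyMeasurable κ
      (Eventually.of_forall fun p => hf.2.2 (φ p))
  have hm : ∀ φ : X × X → X, Continuous φ →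
      traceIntegral f (M.map φ) = traceIntegral (f ∘ φ) M := fun φ hφ =>
    VectorMeasure.integral_map hφ.measurable hc.aestronglyMeasurable (hi φ hφ)
  have hs : traceIntegral (f ∘ Prod.fst) M - traceIntegral (f ∘ Prod.snd) M =
      traceIntegral (f ∘ Prod.fst - f ∘ Prod.snd) M :=
    (VectorMeasure.integral_sub (hi _ continuous_fst) (hi _ continuous_snd)).symm
  rw [traceIntegral_sub hf, hm _ continuous_fst, hm _ continuous_snd, hs]
  refine (enorm_traceIntegral_le _ M).trans (lintegral_mono fun p => ?_)
  rw [edist_dist, ← ofReal_norm]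
  exact ENNReal.ofReal_le_ofReal (hf.2.1 p.1 p.2)

/-- This estimate serves twice: it gives weak duality, and it bounds the error made by discretizing
`μ₁ - μ₂`. -/
theorem traceIntegral_le_of_eq (hf : f ∈ testFunctions X n κ) {σ ρ : MatMeasure X n}
    {M : MatMeasure (X × X) n} (h : σ = M.map Prod.fst - M.map Prod.snd + ρ) :
    ‖traceIntegral f σ‖ₑ ≤
      ∫⁻ p, edist p.1 p.2 ∂(nuclearVariation M) + ENNReal.ofReal κ * tvNorm ρ := by
  rw [h, traceIntegral_add hf]
  exact (enorm_add_le _ _).trans (add_le_add (enorm_traceIntegral_map_sub_map_le hf M)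
    (enorm_traceIntegral_le_mul_tvNorm hf ρ))

theorem dualDist_le_unbalancedValue (𝒜 : Set (MatMeasure X n)) (μ₁ μ₂ : MatMeasure X n) :
    dualDist κ μ₁ μ₂ ≤ (unbalancedValue 𝒜 κ μ₁ μ₂ : EReal) := by
  refine iSup₂_le fun f hf => ?_
  have key : ‖traceIntegral f (μ₁ - μ₂)‖ₑ ≤ unbalancedValue 𝒜 κ μ₁ μ₂ := by
    refine le_iInf₂ fun ν₁ _ => le_iInf₂ fun ν₂ _ => ?_
    rw [matricialW1, ENNReal.iInf_add]
    refine le_iInf fun M => ?_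
    rw [ENNReal.iInf_add]
    refine le_iInf fun hM => ?_
    refine (traceIntegral_le_of_eq hf (M := M) (ρ := (μ₁ - ν₁) - (μ₂ - ν₂)) ?_).trans ?_
    · rw [hM.1, hM.2]
      abel
    · gcongr
      exact tvNorm_sub_le _ _
  calc ((traceIntegral f (μ₁ - μ₂) : ℝ) : EReal)
      ≤ ((‖traceIntegral f (μ₁ - μ₂)‖ₑ : ℝ≥0∞) : EReal) := by
        rw [Real.enorm_eq_ofReal_abs, EReal.coe_ennreal_ofReal, max_eq_left (abs_nonneg _)]
        exact EReal.coe_le_coe_iff.2 (le_abs_self _)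
    _ ≤ _ := EReal.coe_ennreal_le_coe_ennreal_iff.2 key

end TestFunctions

/-! ### Atomic measures, positivity and restriction -/

section MatMeasureLemmas

variable {X : Type*} [MeasurableSpace X] {n : ℕ}

/-- The finitely supported Hermitian-valued measure with the given atoms. -/
def toMatMeasure (X : Type*) [MeasurableSpace X] (n : ℕ) :
    (X →₀ HermMat n) →ₗ[ℝ] MatMeasure X n :=
  Finsupp.lsum ℝ fun x =>
    { toFun := fun A => VectorMeasure.dirac x (A : CMat n)
      map_add' := fun A B => by
        ext1 s hs
        by_cases hx : x ∈ s <;> simp [hx, hs]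
      map_smul' := fun c A => by
        ext1 s hs
        by_cases hx : x ∈ s <;> simp [hx, hs] }

theorem toMatMeasure_single (x : X) (A : HermMat n) :
    toMatMeasure X n (Finsupp.single x A) = VectorMeasure.dirac x (A : CMat n) := by
  simp [toMatMeasure]

theorem isPosSemidefMeasure_zero : IsPosSemidefMeasure (0 : MatMeasure X n) :=
  fun _ _ => Matrix.PosSemidef.zero

theorem IsPosSemidefMeasure.add {m m' : MatMeasure X n} (h : IsPosSemidefMeasure m)
    (h' : IsPosSemidefMeasure m') : IsPosSemidefMeasure (m + m') :=
  fun s hs => (h s hs).add (h' s hs)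

theorem IsPosSemidefMeasure.smul {m : MatMeasure X n} (h : IsPosSemidefMeasure m) {c : ℝ}
    (hc : 0 ≤ c) : IsPosSemidefMeasure (c • m) :=
  fun s hs => (h s hs).smul hc

theorem IsPosSemidefMeasure.isHermitianMeasure {m : MatMeasure X n} (h : IsPosSemidefMeasure m) :
    IsHermitianMeasure m :=
  fun s hs => (h s hs).isHermitian

theorem isPosSemidefMeasure_dirac (x : X) {A : CMat n} (hA : A.PosSemidef) :
    IsPosSemidefMeasure (VectorMeasure.dirac x A : MatMeasure X n) := fun s hs => by
  by_cases hx : x ∈ s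
  · simpa [hx, hs] using hA
  · simpa [hx, hs] using Matrix.PosSemidef.zero

theorem IsHermitianMeasure.sub {m m' : MatMeasure X n} (h : IsHermitianMeasure m)
    (h' : IsHermitianMeasure m') : IsHermitianMeasure (m - m') :=
  fun s hs => (h s hs).sub (h' s hs)

theorem tvNorm_restrict_le (m : MatMeasure X n) {s : Set X} (hs : MeasurableSet s) :
    tvNorm (m.restrict s) ≤ nuclearVariation m s := by
  refine (nuclearVariation_restrict_le m hs Set.univ).trans ?_
  rw [Measure.restrict_apply_univ]

theorem sub_restrict_eq (m : MatMeasure X n) {s : Set X} (hs : MeasurableSet s) :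
    m - m.restrict s = m.restrict sᶜ := by
  rw [sub_eq_iff_eq_add', VectorMeasure.restrict_add_restrict_compl hs]

theorem IsPosSemidefMeasure.restrict {m : MatMeasure X n} (h : IsPosSemidefMeasure m) {K : Set X}
    (hK : MeasurableSet K) : IsPosSemidefMeasure (m.restrict K) := fun s hs => by
  rw [VectorMeasure.restrict_apply _ hK hs]
  exact h _ (hs.inter hK)

theorem IsHermitianMeasure.restrict {m : MatMeasure X n} (h : IsHermitianMeasure m) {K : Set X}
    (hK : MeasurableSet K) : IsHermitianMeasure (m.restrict K) := fun s hs => by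
  rw [VectorMeasure.restrict_apply _ hK hs]
  exact h _ (hs.inter hK)

theorem IsHermitianMeasure.add {m m' : MatMeasure X n} (h : IsHermitianMeasure m)
    (h' : IsHermitianMeasure m') : IsHermitianMeasure (m + m') :=
  fun s hs => (h s hs).add (h' s hs)

theorem restrict_biUnion_finset (m : MatMeasure X n) {ι : Type*} {A : ι → Set X}
    (hA : ∀ i, MeasurableSet (A i)) (hd : Pairwise (Function.onFun Disjoint A)) (s : Finset ι) :
    m.restrict (⋃ i ∈ s, A i) = ∑ i ∈ s, m.restrict (A i) := by
  classical
  induction s using Finset.induction_on with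
  | empty => simp
  | insert i s his ih =>
    rw [Finset.sum_insert his, ← ih, Finset.set_biUnion_insert]
    refine VectorMeasure.restrict_union ?_ (hA i) (s.measurableSet_biUnion fun j _ => hA j)
    rw [Set.disjoint_iUnion₂_right]
    exact fun j hj => hd (ne_of_mem_of_not_mem hj his).symm

theorem tvNorm_smul_le {c : ℝ} (hc : 0 ≤ c) (m : MatMeasure X n) :
    tvNorm (c • m) ≤ ENNReal.ofReal c * tvNorm m :=
  nuclearVariation_smul_le hc m Set.univ

theorem tvNorm_zero : tvNorm (0 : MatMeasure X n) = 0 := by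
  simp [tvNorm, nuclearVariation_zero]

theorem tvNorm_dirac_le (x : X) (A : CMat n) :
    tvNorm (VectorMeasure.dirac x A : MatMeasure X n) ≤ ENNReal.ofReal (nuclearNorm A) := by
  refine (nuclearVariation_dirac_le x A Set.univ).trans ?_
  simp

/-- Polarization: `A = ((A + 1) / 2)² - ((A - 1) / 2)²`, a difference of squares of Hermitian
matrices. Optimality plays no role, since this is used only to see that costs are finite. -/
theorem exists_posSemidef_sub {A : CMat n} (hA : A.IsHermitian) :
    ∃ P Q : CMat n, P.PosSemidef ∧ Q.PosSemidef ∧ A = P - Q := by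
  have h1 : ((1 / 2 : ℝ) • (A + 1))ᴴ = (1 / 2 : ℝ) • (A + 1) := by
    simp [Matrix.conjTranspose_smul, hA.eq]
  have h2 : ((1 / 2 : ℝ) • (A - 1))ᴴ = (1 / 2 : ℝ) • (A - 1) := by
    simp [Matrix.conjTranspose_smul, hA.eq]
  refine ⟨_, _, Matrix.posSemidef_conjTranspose_mul_self ((1 / 2 : ℝ) • (A + 1)),
    Matrix.posSemidef_conjTranspose_mul_self ((1 / 2 : ℝ) • (A - 1)), ?_⟩
  rw [h1, h2]
  simp only [smul_mul_smul_comm, ← smul_sub]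
  have : (A + 1) * (A + 1) - (A - 1) * (A - 1) = (4 : ℝ) • A := by
    rw [show (4 : ℝ) • A = A + A + A + A by
      rw [show (4 : ℝ) = 1 + 1 + 1 + 1 by norm_num]; simp only [add_smul, one_smul]]
    noncomm_ring
  rw [this, smul_smul]
  norm_num

end MatMeasureLemmas

/-! ### The sublinear cost and Hahn-Banach -/

section Feasibility

variable {X : Type*} [MetricSpace X] [MeasurableSpace X] {n : ℕ}

/-- The mass costs at most `c` when part of it is transported along a signed plan and the rest is
split into a positive and a negative part and discarded. -/
def Feasible (κ : ℝ) (s : X →₀ HermMat n) (c : ℝ) : Prop :=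
  0 ≤ c ∧ ∃ (M : MatMeasure (X × X) n) (P Q : MatMeasure X n),
    IsPosSemidefMeasure P ∧ IsPosSemidefMeasure Q ∧
    toMatMeasure X n s = M.map Prod.fst - M.map Prod.snd + (P - Q) ∧
    ∫⁻ p, edist p.1 p.2 ∂(nuclearVariation M) + ENNReal.ofReal κ * (tvNorm P + tvNorm Q) ≤
      ENNReal.ofReal c

variable {κ : ℝ}

theorem Feasible.mono {s : X →₀ HermMat n} {c d : ℝ} (h : Feasible κ s c) (hcd : c ≤ d) :
    Feasible κ s d := by
  obtain ⟨hc, M, P, Q, hP, hQ, hs, hle⟩ := h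
  exact ⟨hc.trans hcd, M, P, Q, hP, hQ, hs, hle.trans (ENNReal.ofReal_le_ofReal hcd)⟩

theorem Feasible.add {s t : X →₀ HermMat n} {c d : ℝ} (hs : Feasible κ s c)
    (ht : Feasible κ t d) : Feasible κ (s + t) (c + d) := by
  obtain ⟨hc, M, P, Q, hP, hQ, hs, hle⟩ := hs
  obtain ⟨hd, M', P', Q', hP', hQ', ht, hle'⟩ := ht
  refine ⟨add_nonneg hc hd, M + M', P + P', Q + Q', hP.add hP', hQ.add hQ', ?_, ?_⟩
  · rw [map_add, hs, ht, VectorMeasure.map_add, VectorMeasure.map_add]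
    abel
  · rw [ENNReal.ofReal_add hc hd]
    refine le_trans ?_ (add_le_add hle hle')
    calc _ ≤ (∫⁻ p, edist p.1 p.2 ∂(nuclearVariation M + nuclearVariation M')) +
          ENNReal.ofReal κ * ((tvNorm P + tvNorm P') + (tvNorm Q + tvNorm Q')) := by
          gcongr
          · exact nuclearVariation_add_le M M'
          · exact tvNorm_add_le P P'
          · exact tvNorm_add_le Q Q'
      _ = _ := by
          rw [lintegral_add_measure]
          ring

theorem Feasible.smul {s : X →₀ HermMat n} {c : ℝ} (hs : Feasible κ s c) {a : ℝ} (ha : 0 ≤ a) :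
    Feasible κ (a • s) (a * c) := by
  obtain ⟨hc, M, P, Q, hP, hQ, hs, hle⟩ := hs
  refine ⟨mul_nonneg ha hc, a • M, a • P, a • Q, hP.smul ha, hQ.smul ha, ?_, ?_⟩
  · rw [map_smul, hs, VectorMeasure.map_smul, VectorMeasure.map_smul, smul_add, smul_sub, smul_sub]
  · rw [ENNReal.ofReal_mul ha]
    refine le_trans ?_ (mul_le_mul_right hle _)
    calc _ ≤ (∫⁻ p, edist p.1 p.2 ∂(ENNReal.ofReal a • nuclearVariation M)) +
          ENNReal.ofReal κ * (ENNReal.ofReal a * tvNorm P + ENNReal.ofReal a * tvNorm Q) := by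
          gcongr
          · exact nuclearVariation_smul_le ha M
          · exact tvNorm_smul_le ha P
          · exact tvNorm_smul_le ha Q
      _ = _ := by
          rw [lintegral_smul_measure, smul_eq_mul]
          ring

theorem feasible_zero : Feasible κ (0 : X →₀ HermMat n) 0 :=
  ⟨le_rfl, 0, 0, 0, isPosSemidefMeasure_zero, isPosSemidefMeasure_zero, by simp,
    by simp [nuclearVariation_zero, tvNorm_zero]⟩

theorem feasible_single (hκ : 0 ≤ κ) (x : X) (A : HermMat n) {P Q : CMat n} (hP : P.PosSemidef)
    (hQ : Q.PosSemidef) (hA : (A : CMat n) = P - Q) :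
    Feasible κ (Finsupp.single x A) (κ * (nuclearNorm P + nuclearNorm Q)) := by
  have h0 : 0 ≤ nuclearNorm P + nuclearNorm Q :=
    add_nonneg (nuclearNorm_nonneg P) (nuclearNorm_nonneg Q)
  refine ⟨mul_nonneg hκ h0, 0, VectorMeasure.dirac x P, VectorMeasure.dirac x Q,
    isPosSemidefMeasure_dirac x hP, isPosSemidefMeasure_dirac x hQ, ?_, ?_⟩
  · rw [toMatMeasure_single, hA]
    ext1 s hs
    by_cases hx : x ∈ s <;> simp [hx, hs]
  · rw [nuclearVariation_zero, lintegral_zero_measure, zero_add, ENNReal.ofReal_mul hκ,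
      ENNReal.ofReal_add (nuclearNorm_nonneg P) (nuclearNorm_nonneg Q)]
    gcongr <;> exact tvNorm_dirac_le _ _

/-- This ensures that the infimum in `minCost` is over a nonempty set, so that it is not the default
value `0` of `sInf`. -/
theorem exists_feasible (hκ : 0 ≤ κ) (s : X →₀ HermMat n) : ∃ c, Feasible κ s c := by
  induction s using Finsupp.induction_linear with
  | zero => exact ⟨0, feasible_zero⟩
  | add s t hs ht =>
    obtain ⟨c, hc⟩ := hs
    obtain ⟨d, hd⟩ := ht
    exact ⟨c + d, hc.add hd⟩
  | single x A =>
    obtain ⟨P, Q, hP, hQ, hA⟩ := exists_posSemidef_sub (mem_hermMat.1 A.2)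
    exact ⟨_, feasible_single hκ x A hP hQ hA⟩

/-- The plan is a single atom at `(x, y)` with the Hermitian, possibly indefinite, weight `A`.
Nothing is discarded. -/
theorem feasible_single_add_single_neg [SecondCountableTopology X] [BorelSpace X] (x y : X)
    (A : HermMat n) :
    Feasible κ (Finsupp.single x A + Finsupp.single y (-A))
      (dist x y * nuclearNorm (A : CMat n)) := by
  refine ⟨mul_nonneg dist_nonneg (nuclearNorm_nonneg _), VectorMeasure.dirac (x, y) (A : CMat n),
    0, 0, isPosSemidefMeasure_zero, isPosSemidefMeasure_zero, ?_, ?_⟩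
  · have hneg : (VectorMeasure.dirac y ((-A : HermMat n) : CMat n) : MatMeasure X n) =
        -VectorMeasure.dirac y (A : CMat n) := by
      ext1 s hs
      by_cases hx : y ∈ s <;> simp [hx, hs]
    rw [map_add, toMatMeasure_single, toMatMeasure_single, hneg, ← sub_eq_add_neg, sub_zero,
      add_zero]
    congr 1 <;> ext1 s hs <;> rw [VectorMeasure.map_apply _ (by fun_prop) hs]
    · by_cases hx : x ∈ s
      · rw [VectorMeasure.dirac_apply_of_mem hs hx,
          VectorMeasure.dirac_apply_of_mem (measurable_fst hs) hx]
      · rw [VectorMeasure.dirac_apply_of_notMem hx,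
          VectorMeasure.dirac_apply_of_notMem (s := Prod.fst ⁻¹' s) hx]
    · by_cases hx : y ∈ s
      · rw [VectorMeasure.dirac_apply_of_mem hs hx,
          VectorMeasure.dirac_apply_of_mem (measurable_snd hs) hx]
      · rw [VectorMeasure.dirac_apply_of_notMem hx,
          VectorMeasure.dirac_apply_of_notMem (s := Prod.snd ⁻¹' s) hx]
  · rw [tvNorm_zero, add_zero, mul_zero, add_zero]
    refine (lintegral_mono' (nuclearVariation_dirac_le _ _) le_rfl).trans ?_
    rw [lintegral_smul_measure, lintegral_dirac' _ measurable_edist, smul_eq_mul, mul_comm,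
      ENNReal.ofReal_mul dist_nonneg, edist_dist]

/-- The least cost of a finitely supported Hermitian-valued measure. -/
def minCost (κ : ℝ) (s : X →₀ HermMat n) : ℝ := sInf {c | Feasible κ s c}

theorem bddBelow_feasible (s : X →₀ HermMat n) : BddBelow {c | Feasible κ s c} :=
  ⟨0, fun _ h => h.1⟩

theorem minCost_le {s : X →₀ HermMat n} {c : ℝ} (h : Feasible κ s c) : minCost κ s ≤ c :=
  csInf_le (bddBelow_feasible s) h

theorem minCost_nonneg (s : X →₀ HermMat n) : 0 ≤ minCost κ s :=
  Real.sInf_nonneg fun _ h => h.1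

theorem minCost_zero : minCost κ (0 : X →₀ HermMat n) = 0 :=
  le_antisymm (minCost_le feasible_zero) (minCost_nonneg _)

theorem feasible_of_minCost_lt (hκ : 0 ≤ κ) {s : X →₀ HermMat n} {c : ℝ} (h : minCost κ s < c) :
    Feasible κ s c := by
  obtain ⟨d, hd, hdc⟩ := exists_lt_of_csInf_lt (exists_feasible hκ s) h
  exact Feasible.mono hd hdc.le

theorem minCost_add_le (hκ : 0 ≤ κ) (s t : X →₀ HermMat n) :
    minCost κ (s + t) ≤ minCost κ s + minCost κ t := by
  refine le_of_forall_pos_le_add fun ε hε => ?_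
  have hs := feasible_of_minCost_lt hκ (lt_add_of_pos_right (minCost κ s) (half_pos hε))
  have ht := feasible_of_minCost_lt hκ (lt_add_of_pos_right (minCost κ t) (half_pos hε))
  linarith [minCost_le (hs.add ht)]

theorem minCost_smul (hκ : 0 ≤ κ) (a : ℝ) (ha : 0 < a) (s : X →₀ HermMat n) :
    minCost κ (a • s) = a * minCost κ s := by
  have key : ∀ (b : ℝ) (t : X →₀ HermMat n), 0 < b → minCost κ (b • t) ≤ b * minCost κ t := by
    intro b t hb
    rw [← div_le_iff₀' hb]
    refine le_csInf (exists_feasible hκ t) fun c hc => ?_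
    rw [div_le_iff₀' hb]
    exact minCost_le (Feasible.smul hc hb.le)
  refine le_antisymm (key a s ha) ?_
  -- The reverse inequality is the same bound applied to the inverse scaling.
  have h := key a⁻¹ (a • s) (inv_pos.2 ha)
  rw [smul_smul, inv_mul_cancel₀ ha.ne', one_smul] at h
  rwa [← le_inv_mul_iff₀ ha]

/-- Hahn-Banach, extending `a • s ↦ a * minCost κ s` from the line through `s`. For `s = 0` this
line degenerates and the zero subspace is used instead. -/
theorem exists_linear_le_minCost (hκ : 0 ≤ κ) (s : X →₀ HermMat n) :
    ∃ l : (X →₀ HermMat n) →ₗ[ℝ] ℝ, l s = minCost κ s ∧ ∀ t, l t ≤ minCost κ t := by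
  rcases eq_or_ne s 0 with rfl | hs
  · obtain ⟨l, -, hl⟩ := exists_extension_of_le_sublinear (⊥ : (X →₀ HermMat n) →ₗ.[ℝ] ℝ)
      (minCost κ) (minCost_smul hκ) (minCost_add_le hκ) (fun x => by
        have hx : (x : X →₀ HermMat n) = 0 := (Submodule.mem_bot ℝ).1 x.2
        rw [hx, minCost_zero, show x = 0 from Subtype.ext hx, LinearPMap.map_zero])
    exact ⟨l, by rw [map_zero, minCost_zero], hl⟩
  · obtain ⟨l, hl, hl'⟩ := exists_extension_of_le_sublinear
      (LinearPMap.mkSpanSingleton s (minCost κ s) hs)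
      (minCost κ) (minCost_smul hκ) (minCost_add_le hκ) (fun x => by
        obtain ⟨x, hx⟩ := x
        obtain ⟨a, rfl⟩ := Submodule.mem_span_singleton.1 hx
        refine (LinearPMap.mkSpanSingleton'_apply s (minCost κ s) _ a hx).trans_le ?_
        rw [RingHom.id_apply, smul_eq_mul]
        rcases lt_or_ge 0 a with ha | ha
        · exact (minCost_smul hκ a ha s).ge
        -- For nonpositive multiples the functional is at most zero, and the cost is never negative.
        · exact (mul_nonpos_of_nonpos_of_nonneg ha (minCost_nonneg s)).trans (minCost_nonneg _))
    refine ⟨l, ?_, hl'⟩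
    exact (hl ⟨s, Submodule.mem_span_singleton_self s⟩).trans
      (LinearPMap.mkSpanSingleton'_apply_self s (minCost κ s) _ _)

theorem traceIntegral_dirac [BorelSpace X] (f : X → CMat n) (x : X) (A : CMat n) :
    traceIntegral f (VectorMeasure.dirac x A) = (f x * A).trace.re :=
  VectorMeasure.integral_dirac

variable [SecondCountableTopology X] [BorelSpace X]

theorem exists_mem_testFunctions_feasible (hκ : 0 ≤ κ) (s : X →₀ HermMat n) :
    ∃ f ∈ testFunctions X n κ,
      ∀ ε > 0, Feasible κ s (traceIntegral f (toMatMeasure X n s) + ε) := by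
  obtain ⟨l, hls, hl⟩ := exists_linear_le_minCost hκ s
  -- The value `f x` represents the functional on atoms at `x`. No regularity is known yet; it comes
  -- from `l ≤ minCost`.
  choose f hf hfl using fun x => exists_hermitian_repr (l ∘ₗ Finsupp.lsingle x)
  have hfl' : ∀ x A, l (Finsupp.single x A) = (f x * A).trace.re := hfl
  have hps : ∀ v : Fin n → ℂ, (Matrix.vecMulVec v (star v)).PosSemidef :=
    fun v => Matrix.posSemidef_vecMulVec_self_star v
  have hft : f ∈ testFunctions X n κ := by
    refine ⟨hf, fun x y => ?_, fun x => ?_⟩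
    · refine norm_le_of_forall_abs_re_trace ((hf x).sub (hf y)) dist_nonneg fun v => ?_
      let A : HermMat n := ⟨Matrix.vecMulVec v (star v), (hps v).isHermitian⟩
      have key : ∀ x y, ((f x - f y) * (A : CMat n)).trace.re ≤
          dist x y * nuclearNorm (A : CMat n) := by
        intro x y
        have h := (hl _).trans (minCost_le (feasible_single_add_single_neg (κ := κ) x y A))
        rw [map_add, hfl', hfl', Submodule.coe_neg] at h
        simpa [sub_mul] using h
      refine abs_le'.2 ⟨key x y, ?_⟩
      have h := key y x
      rw [dist_comm, ← neg_sub, neg_mul, Matrix.trace_neg, Complex.neg_re] at h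
      exact h
    · refine norm_le_of_forall_abs_re_trace (hf x) hκ fun v => ?_
      let A : HermMat n := ⟨Matrix.vecMulVec v (star v), (hps v).isHermitian⟩
      have h0 : nuclearNorm (0 : CMat n) = 0 := (nuclearNorm_eq_zero_iff _).2 rfl
      -- An atom of weight `v v*` is discarded entirely as `P`, and one of weight `-v v*` entirely
      -- as `Q`. Each costs `κ` times the nuclear norm of `v v*`, which gives the two signs of the
      -- bound.
      have h1 := (hl _).trans (minCost_le (feasible_single hκ x A (hps v)
        Matrix.PosSemidef.zero (sub_zero _).symm))
      have h2 := (hl _).trans (minCost_le (feasible_single hκ x (-A) Matrix.PosSemidef.zero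
        (hps v) (zero_sub _).symm))
      rw [hfl', h0, add_zero] at h1
      rw [hfl', h0, zero_add, Submodule.coe_neg, mul_neg, Matrix.trace_neg, Complex.neg_re] at h2
      exact abs_le'.2 ⟨h1, h2⟩
  have hlt : ∀ t, l t = traceIntegral f (toMatMeasure X n t) := by
    intro t
    induction t using Finsupp.induction_linear with
    | zero =>
      have h := traceIntegral_sub hft 0 0
      rw [sub_self, sub_self] at h
      rw [map_zero, map_zero, h]
    | add t u ht hu => rw [map_add, map_add, ht, hu, traceIntegral_add hft]
    | single x A => rw [hfl', toMatMeasure_single, traceIntegral_dirac]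
  refine ⟨f, hft, fun ε hε => feasible_of_minCost_lt hκ ?_⟩
  rw [← hlt, hls]
  exact lt_add_of_pos_right _ hε

end Feasibility

/-! ### Discretization and strong duality -/

section Discretization

variable {X : Type*} [MetricSpace X] [SecondCountableTopology X] [MeasurableSpace X]
    [BorelSpace X] {n : ℕ}

/-- Every separable metric space is a countable disjoint union of small Borel sets. -/
theorem exists_disjoint_measurable_cover [Nonempty X] {δ : ℝ} (hδ : 0 < δ) :
    ∃ (x : ℕ → X) (A : ℕ → Set X), (∀ k, MeasurableSet (A k)) ∧
      Pairwise (Function.onFun Disjoint A) ∧ (⋃ k, A k) = Set.univ ∧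
      ∀ k, ∀ y ∈ A k, dist y (x k) ≤ δ := by
  refine ⟨TopologicalSpace.denseSeq X,
    disjointed fun k => Metric.ball (TopologicalSpace.denseSeq X k) δ,
    fun k => MeasurableSet.disjointed (fun _ => measurableSet_ball) k, disjoint_disjointed _, ?_,
    fun k y hy => (Metric.mem_ball.1 (disjointed_subset _ k hy)).le⟩
  rw [iUnion_disjointed, Set.eq_univ_iff_forall]
  intro y
  obtain ⟨k, hk⟩ := (TopologicalSpace.denseRange_denseSeq X).exists_dist_lt y hδ
  exact Set.mem_iUnion.2 ⟨k, hk⟩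

theorem exists_measure_compl_biUnion_le {X : Type*} [MeasurableSpace X] (l : Measure X)
    [IsFiniteMeasure l] {A : ℕ → Set X} (hA : ∀ k, MeasurableSet (A k))
    (hU : (⋃ k, A k) = Set.univ) {ε : ℝ≥0∞} (hε : 0 < ε) :
    ∃ N, l (⋃ k ∈ Finset.range N, A k)ᶜ ≤ ε := by
  have h := tendsto_measure_iInter_atTop (μ := l)
    (s := fun N => (⋃ k ∈ Finset.range N, A k)ᶜ)
    (fun N => ((Finset.range N).measurableSet_biUnion fun k _ => hA k).compl.nullMeasurableSet)
    (fun M N hMN => Set.compl_subset_compl.2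
      (Set.biUnion_subset_biUnion_left (by simpa using hMN)))
    ⟨0, measure_ne_top _ _⟩
  have h0 : (⋂ N, (⋃ k ∈ Finset.range N, A k)ᶜ) = ∅ := by
    rw [← Set.compl_iUnion, Set.compl_empty_iff, Set.eq_univ_iff_forall]
    intro y
    obtain ⟨k, hk⟩ := Set.mem_iUnion.1 (hU ▸ Set.mem_univ y)
    exact Set.mem_iUnion.2 ⟨k + 1, Set.mem_biUnion (by simp) hk⟩
  rw [h0, measure_empty] at h
  exact ((h.eventually (gt_mem_nhds hε)).exists).imp fun N hN => le_of_lt hN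

/-- Up to a set of small measure, a Hermitian-valued measure is transported at small cost to a
finitely supported one. -/
theorem exists_discretization [Nonempty X] {σ : MatMeasure X n} (hσ : IsHermitianMeasure σ)
    (l : Measure X) [IsFiniteMeasure l] {ε : ℝ} (hε : 0 < ε) :
    ∃ (K : Set X) (s : X →₀ HermMat n) (M : MatMeasure (X × X) n), MeasurableSet K ∧
      l Kᶜ ≤ ENNReal.ofReal ε ∧
      σ.restrict K = M.map Prod.fst - M.map Prod.snd + toMatMeasure X n s ∧
      ∫⁻ p, edist p.1 p.2 ∂(nuclearVariation M) ≤ ENNReal.ofReal ε := by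
  -- Points are moved by at most `ε / (C + 1)`, so the total cost is at most `ε C / (C + 1) ≤ ε`.
  -- The summand `1` avoids division by zero when `σ = 0`.
  set C := (nuclearVariation σ Set.univ).toReal with hC
  have hC0 : 0 ≤ C := ENNReal.toReal_nonneg
  have hC1 : 0 < C + 1 := by linarith
  obtain ⟨x, A, hA, hd, hU, hx⟩ := exists_disjoint_measurable_cover (X := X) (div_pos hε hC1)
  obtain ⟨N, hN⟩ := exists_measure_compl_biUnion_le l hA hU (ENNReal.ofReal_pos.2 hε)
  have hφ : ∀ k, Measurable fun y : X => (y, x k) := fun k => by fun_prop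
  -- Each piece `A k` is collapsed to its centre `x k`.
  let M : MatMeasure (X × X) n :=
    ∑ k ∈ Finset.range N, (σ.restrict (A k)).map fun y => (y, x k)
  have hmap : ∀ φ : X × X → X, M.map φ =
      ∑ k ∈ Finset.range N, ((σ.restrict (A k)).map fun y => (y, x k)).map φ :=
    fun φ => map_sum (VectorMeasure.mapGm φ) _ _
  have hfst : M.map Prod.fst = σ.restrict (⋃ k ∈ Finset.range N, A k) := by
    rw [hmap, restrict_biUnion_finset σ hA hd]
    refine Finset.sum_congr rfl fun k _ => ?_
    ext1 t ht
    rw [VectorMeasure.map_apply _ measurable_fst ht,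
      VectorMeasure.map_apply _ (hφ k) (measurable_fst ht)]
    rfl
  have hsnd : M.map Prod.snd = toMatMeasure X n
      (∑ k ∈ Finset.range N, Finsupp.single (x k) ⟨σ (A k), hσ _ (hA k)⟩) := by
    rw [hmap, map_sum]
    refine Finset.sum_congr rfl fun k _ => ?_
    rw [toMatMeasure_single]
    ext1 t ht
    rw [VectorMeasure.map_apply _ measurable_snd ht,
      VectorMeasure.map_apply _ (hφ k) (measurable_snd ht)]
    by_cases hxt : x k ∈ t
    · rw [VectorMeasure.dirac_apply_of_mem ht hxt,
        VectorMeasure.restrict_apply _ (hA k) (hφ k (measurable_snd ht))]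
      congr 1
      ext y
      simp [hxt]
    · rw [VectorMeasure.dirac_apply_of_notMem hxt,
        VectorMeasure.restrict_apply _ (hA k) (hφ k (measurable_snd ht))]
      rw [← VectorMeasure.empty σ]
      congr 1
      ext y
      simp [hxt]
  refine ⟨⋃ k ∈ Finset.range N, A k,
    ∑ k ∈ Finset.range N, Finsupp.single (x k) ⟨σ (A k), hσ _ (hA k)⟩, M,
    (Finset.range N).measurableSet_biUnion fun k _ => hA k, hN, ?_, ?_⟩
  · rw [← hfst, ← hsnd, sub_add_cancel]
  · have hterm : ∀ k, ∫⁻ p, edist p.1 p.2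
        ∂(nuclearVariation ((σ.restrict (A k)).map fun y => (y, x k))) ≤
        ENNReal.ofReal (ε / (C + 1)) * nuclearVariation σ (A k) := by
      intro k
      refine (lintegral_mono' (nuclearVariation_map_le _ (hφ k)) le_rfl).trans ?_
      rw [lintegral_map measurable_edist (hφ k)]
      refine (lintegral_mono' (nuclearVariation_restrict_le σ (hA k)) le_rfl).trans ?_
      rw [← setLIntegral_const]
      refine setLIntegral_mono measurable_const fun y hy => ?_
      rw [edist_dist]
      exact ENNReal.ofReal_le_ofReal (hx k y hy)
    calc _ ≤ ∫⁻ p, edist p.1 p.2 ∂(∑ k ∈ Finset.range N,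
            nuclearVariation ((σ.restrict (A k)).map fun y => (y, x k))) :=
          lintegral_mono' (nuclearVariation_sum_le _ _) le_rfl
      _ ≤ ∑ k ∈ Finset.range N, ENNReal.ofReal (ε / (C + 1)) * nuclearVariation σ (A k) := by
          rw [lintegral_finsetSum_measure]
          exact Finset.sum_le_sum fun k _ => hterm k
      _ ≤ ENNReal.ofReal (ε / (C + 1)) * nuclearVariation σ Set.univ := by
          rw [← Finset.mul_sum, ← measure_biUnion_finset (fun i _ j _ hij => hd hij)
            fun k _ => hA k]
          gcongr
          exact Set.subset_univ _
      _ = ENNReal.ofReal (ε / (C + 1) * C) := by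
          rw [ENNReal.ofReal_mul (div_pos hε hC1).le, hC,
            ENNReal.ofReal_toReal (measure_ne_top _ _)]
      _ ≤ ENNReal.ofReal ε := by
          refine ENNReal.ofReal_le_ofReal ?_
          rw [div_mul_eq_mul_div, div_le_iff₀ hC1]
          nlinarith

/-- The diagonal costs nothing, so that a plan may be corrected to have prescribed marginals with
the same difference. -/
theorem matricialW1_le_of_sub_eq {ν₁ ν₂ : MatMeasure X n} {M : MatMeasure (X × X) n}
    (h : ν₁ - ν₂ = M.map Prod.fst - M.map Prod.snd) :
    matricialW1 ν₁ ν₂ ≤ ∫⁻ p, edist p.1 p.2 ∂(nuclearVariation M) := by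
  have hΔ : Measurable fun y : X => (y, y) := by fun_prop
  -- The second marginal of `M` misses `ν₂` by this measure, and by hypothesis the first misses `ν₁`
  -- by the same one. It need not be positive, so signed plans are essential here.
  let D : MatMeasure (X × X) n := (ν₂ - M.map Prod.snd).map fun y => (y, y)
  have hD : D.map Prod.fst = ν₂ - M.map Prod.snd ∧ D.map Prod.snd = ν₂ - M.map Prod.snd := by
    constructor <;> ext1 t ht
    · rw [VectorMeasure.map_apply _ measurable_fst ht,
        VectorMeasure.map_apply _ hΔ (measurable_fst ht)]
      rfl
    · rw [VectorMeasure.map_apply _ measurable_snd ht,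
        VectorMeasure.map_apply _ hΔ (measurable_snd ht)]
      rfl
  have hmem : M + D ∈ couplings ν₁ ν₂ := by
    constructor
    · rw [VectorMeasure.map_add, hD.1, sub_eq_iff_eq_add.1 h]
      abel
    · rw [VectorMeasure.map_add, hD.2]
      abel
  refine (iInf₂_le (M + D) hmem).trans ?_
  refine (lintegral_mono' (nuclearVariation_add_le M D) le_rfl).trans ?_
  rw [lintegral_add_measure]
  have h0 : ∫⁻ p, edist p.1 p.2 ∂(nuclearVariation D) = 0 := by
    refine le_antisymm ((lintegral_mono' (nuclearVariation_map_le _ hΔ) le_rfl).trans ?_) zero_le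
    rw [lintegral_map measurable_edist hΔ]
    simp
  rw [h0, add_zero]

/-- Strong duality up to `ε`. The class `𝒜` only has to contain the restrictions of `μ₁` and `μ₂`
with positive measures added, which covers the positive and the Hermitian problem together. -/
theorem unbalancedValue_le_of_forall {κ : ℝ} (hκ : 0 < κ) {𝒜 : Set (MatMeasure X n)}
    {μ₁ μ₂ : MatMeasure X n} (hμ₁ : IsHermitianMeasure μ₁) (hμ₂ : IsHermitianMeasure μ₂)
    (h₁ : ∀ K P, MeasurableSet K → IsPosSemidefMeasure P → μ₁.restrict K + P ∈ 𝒜)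
    (h₂ : ∀ K P, MeasurableSet K → IsPosSemidefMeasure P → μ₂.restrict K + P ∈ 𝒜)
    {ε : ℝ} (hε : 0 < ε) :
    ∃ f ∈ testFunctions X n κ, 0 ≤ traceIntegral f (μ₁ - μ₂) + ε ∧
      unbalancedValue 𝒜 κ μ₁ μ₂ ≤ ENNReal.ofReal (traceIntegral f (μ₁ - μ₂) + ε) := by
  -- Discretization needs points to serve as centres; on an empty space every measure is zero.
  rcases isEmpty_or_nonempty X with hX | hX
  · refine ⟨0, zero_mem_testFunctions hκ.le, ?_, ?_⟩
    · rw [VectorMeasure.eq_zero_of_isEmpty (μ₁ - μ₂)]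
      have h := traceIntegral_sub (zero_mem_testFunctions (X := X) (n := n) hκ.le) 0 0
      rw [sub_self, sub_self] at h
      rw [h]
      linarith
    · have h0 : (0 : MatMeasure X n) ∈ 𝒜 := by
        have h := h₁ Set.univ 0 MeasurableSet.univ isPosSemidefMeasure_zero
        rwa [VectorMeasure.eq_zero_of_isEmpty (_ + _)] at h
      refine (iInf₂_le (0 : MatMeasure X n) h0).trans ((iInf₂_le (0 : MatMeasure X n) h0).trans ?_)
      rw [VectorMeasure.eq_zero_of_isEmpty μ₁, VectorMeasure.eq_zero_of_isEmpty μ₂, sub_self,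
        tvNorm_zero, add_zero, mul_zero, add_zero]
      refine (matricialW1_le_of_sub_eq (M := 0) (by simp)).trans ?_
      simp [nuclearVariation_zero]
  -- The budget is `3η + 2κη`. Replacing `μ₁ - μ₂` by `s` in the integral costs `η + κη`,
  -- near-optimality of `f` costs `η`, the plan `M` costs `η`, and discarding both measures outside
  -- `K` costs `κη`.
  set η := ε / (3 + 2 * κ) with hη
  have hη0 : 0 < η := by positivity
  have hηε : η * (3 + 2 * κ) = ε := by rw [hη]; field_simp
  -- The complement of `K` must be small for `μ₁` and `μ₂` separately, since each is restricted to
  -- `K`; smallness for the difference alone would not suffice.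
  obtain ⟨K, s, M, hK, hl, hres, hM⟩ := exists_discretization (hμ₁.sub hμ₂)
    (nuclearVariation μ₁ + nuclearVariation μ₂) hη0
  obtain ⟨f, hf, hfs⟩ := exists_mem_testFunctions_feasible hκ.le s
  obtain ⟨ha, M', P, Q, hP, hQ, hs, hcost⟩ := hfs η hη0
  have hσK : tvNorm ((μ₁ - μ₂).restrict Kᶜ) ≤ ENNReal.ofReal η :=
    ((tvNorm_restrict_le _ hK.compl).trans (nuclearVariation_sub_le μ₁ μ₂ Kᶜ)).trans hl
  have hsplit : (μ₁ - μ₂) - toMatMeasure X n s =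
      M.map Prod.fst - M.map Prod.snd + (μ₁ - μ₂).restrict Kᶜ := by
    rw [← sub_restrict_eq _ hK, hres]
    abel
  have herr : |traceIntegral f (μ₁ - μ₂) - traceIntegral f (toMatMeasure X n s)| ≤
      η + κ * η := by
    rw [← traceIntegral_sub hf, ← ENNReal.ofReal_le_ofReal_iff (by positivity),
      ← Real.enorm_eq_ofReal_abs, ENNReal.ofReal_add hη0.le (by positivity),
      ENNReal.ofReal_mul hκ.le]
    refine (traceIntegral_le_of_eq hf hsplit).trans ?_
    gcongr
  have hab : traceIntegral f (toMatMeasure X n s) + η + η + κ * η ≤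
      traceIntegral f (μ₁ - μ₂) + ε := by
    have := (abs_le.1 herr).1
    nlinarith
  have hκη : 0 < κ * η := by positivity
  refine ⟨f, hf, by linarith, ?_⟩
  refine le_trans ?_ (ENNReal.ofReal_le_ofReal hab)
  rw [ENNReal.ofReal_add (by linarith) hκη.le, ENNReal.ofReal_add ha hη0.le,
    ENNReal.ofReal_mul hκ.le]
  have htv : ∀ μ R : MatMeasure X n,
      tvNorm (μ - (μ.restrict K + R)) ≤ nuclearVariation μ Kᶜ + tvNorm R := fun μ R => by
    rw [← sub_sub, sub_restrict_eq _ hK]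
    exact (tvNorm_sub_le _ _).trans (add_le_add (tvNorm_restrict_le μ hK.compl) le_rfl)
  -- From `(μ₁ - μ₂)|K = ∂M + ∂M' + P - Q`, where `∂` is the difference of the marginals, moving `P
  -- - Q` to the left shows that `M + M'` has the required marginal difference.
  have hW : matricialW1 (μ₁.restrict K + Q) (μ₂.restrict K + P) ≤
      ENNReal.ofReal η + ∫⁻ p, edist p.1 p.2 ∂(nuclearVariation M') := by
    refine (matricialW1_le_of_sub_eq (M := M + M') ?_).trans ?_
    · have hr := hres
      rw [VectorMeasure.restrict_sub, hs] at hr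
      rw [VectorMeasure.map_add, VectorMeasure.map_add]
      rw [sub_eq_iff_eq_add] at hr
      rw [hr]
      abel
    · refine (lintegral_mono' (nuclearVariation_add_le M M') le_rfl).trans ?_
      rw [lintegral_add_measure]
      gcongr
  calc unbalancedValue 𝒜 κ μ₁ μ₂
      ≤ matricialW1 (μ₁.restrict K + Q) (μ₂.restrict K + P) + ENNReal.ofReal κ *
          (tvNorm (μ₁ - (μ₁.restrict K + Q)) + tvNorm (μ₂ - (μ₂.restrict K + P))) :=
        (iInf₂_le _ (h₁ K Q hK hQ)).trans (iInf₂_le _ (h₂ K P hK hP))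
    _ ≤ (ENNReal.ofReal η + ∫⁻ p, edist p.1 p.2 ∂(nuclearVariation M')) + ENNReal.ofReal κ *
          ((nuclearVariation μ₁ Kᶜ + tvNorm Q) + (nuclearVariation μ₂ Kᶜ + tvNorm P)) := by
        gcongr
        · exact htv μ₁ Q
        · exact htv μ₂ P
    _ = (∫⁻ p, edist p.1 p.2 ∂(nuclearVariation M') +
          ENNReal.ofReal κ * (tvNorm P + tvNorm Q)) + ENNReal.ofReal η +
          ENNReal.ofReal κ * (nuclearVariation μ₁ + nuclearVariation μ₂) Kᶜ := by
        rw [Measure.add_apply]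
        ring
    _ ≤ _ := by gcongr

theorem dualDist_eq_unbalancedValue {κ : ℝ} (hκ : 0 < κ) {𝒜 : Set (MatMeasure X n)}
    {μ₁ μ₂ : MatMeasure X n} (hμ₁ : IsHermitianMeasure μ₁) (hμ₂ : IsHermitianMeasure μ₂)
    (h₁ : ∀ K P, MeasurableSet K → IsPosSemidefMeasure P → μ₁.restrict K + P ∈ 𝒜)
    (h₂ : ∀ K P, MeasurableSet K → IsPosSemidefMeasure P → μ₂.restrict K + P ∈ 𝒜) :
    dualDist κ μ₁ μ₂ = (unbalancedValue 𝒜 κ μ₁ μ₂ : EReal) := by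
  refine le_antisymm (dualDist_le_unbalancedValue 𝒜 μ₁ μ₂) (le_of_not_gt fun hlt => ?_)
  -- Two reals are placed in the supposed gap, and `r - q` serves as the tolerance. Real numbers are
  -- needed since the primal value is not known to be finite in advance.
  obtain ⟨r, hr, hr'⟩ := EReal.lt_iff_exists_real_btwn.1 hlt
  obtain ⟨q, hq, hqr⟩ := EReal.lt_iff_exists_real_btwn.1 hr
  have hqr' : q < r := EReal.coe_lt_coe_iff.1 hqr
  obtain ⟨f, hf, h0, hle⟩ := unbalancedValue_le_of_forall hκ hμ₁ hμ₂ h₁ h₂ (sub_pos.2 hqr')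
  have hfq : ((traceIntegral f (μ₁ - μ₂) : ℝ) : EReal) < q :=
    (le_iSup₂ (f := fun f (_ : f ∈ testFunctions X n κ) =>
      ((traceIntegral f (μ₁ - μ₂) : ℝ) : EReal)) f hf).trans_lt hq
  have hle' := hr'.trans_le (EReal.coe_ennreal_le_coe_ennreal_iff.2 hle)
  -- The nonnegativity obtained together with `f` ensures that `ENNReal.ofReal` does not truncate
  -- the bound.
  rw [EReal.coe_ennreal_ofReal, max_eq_left h0] at hle'
  have h1 := EReal.coe_lt_coe_iff.1 hfq
  have h2 := EReal.coe_lt_coe_iff.1 hle'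
  linarith

end Discretization

end MatricialTransport

end

theorem proposition2 {X : Type*} [MetricSpace X] [SecondCountableTopology X] [MeasurableSpace X]
    [BorelSpace X] (n : ℕ) (κ : ℝ) (hκ : 0 < κ) (μ₁ μ₂ : MatricialTransport.MatMeasure X n) :
    (MatricialTransport.IsPosSemidefMeasure μ₁ → MatricialTransport.IsPosSemidefMeasure μ₂ →
      MatricialTransport.dualDist κ μ₁ μ₂ =
        (MatricialTransport.unbalancedValue
          {ν : MatricialTransport.MatMeasure X n | MatricialTransport.IsPosSemidefMeasure ν}
          κ μ₁ μ₂ : EReal)) ∧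
    (MatricialTransport.IsHermitianMeasure μ₁ → MatricialTransport.IsHermitianMeasure μ₂ →
      MatricialTransport.dualDist κ μ₁ μ₂ =
        (MatricialTransport.unbalancedValue
          {ν : MatricialTransport.MatMeasure X n | MatricialTransport.IsHermitianMeasure ν}
          κ μ₁ μ₂ : EReal)) :=
  ⟨fun h₁ h₂ => MatricialTransport.dualDist_eq_unbalancedValue hκ h₁.isHermitianMeasure
      h₂.isHermitianMeasure (fun _ _ hK hP => (h₁.restrict hK).add hP)
      (fun _ _ hK hP => (h₂.restrict hK).add hP),
    fun h₁ h₂ => MatricialTransport.dualDist_eq_unbalancedValue hκ h₁ h₂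
      (fun _ _ hK hP => (h₁.restrict hK).add hP.isHermitianMeasure)
      (fun _ _ hK hP => (h₂.restrict hK).add hP.isHermitianMeasure)⟩
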